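/- Let $\mathfrak h$ be a finite-dimensional complex Hilbert space, $H$ a Hermitian operator on $\mathfrak h$, $\beta\in\mathbb R$, and $\hat\rho_\beta=Z_\beta^{-1}e^{-\beta H}$ with $Z_\beta=\operatorname{Tr}e^{-\beta H}$. Let $L(\mathfrak h)$ be the algebra of operators on $\mathfrak h$, with Hilbert--Schmidt scalar product $\langle\!\langle A,B\rangle\!\rangle=\operatorname{Tr}(A^*B)$. A linear map $\mathcal L:L(\mathfrak h)\to L(\mathfrak h)$ is a Lindblad operator if $$\mathcal L A=\sum_{n,m}a_{n,m}\big([Q_n,AQ_m^*]+[Q_nA,Q_m^*]\big)$$ for finitely many operators $Q_n\in L(\mathfrak h)$ and a Hermitian positive semidefinite matrix $(a_{n,m})$. It satisfies the detailed balance condition (DBC) with respect to $\hat\rho_\beta$ if $\mathcal L\hat\rho_\beta=0$ and $\langle\!\langle \mathcal L^*(A),B\hat\rho_\beta\rangle\!\rangle=\langle\!\langle A,\mathcal L^*(B)\hat\rho_\beta\rangle\!\rangle$ for all $A,B\in L(\mathfrak h)$, where $\mathcal L^*$ is the adjoint of $\mathcal L$ with respect to $\langle\!\langle\cdot,\cdot\rangle\!\rangle$.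 Put $\mathfrak h_2=\mathfrak h$, and let $\operatorname{Tr}_{\mathfrak h_2}:L(\mathfrak h\otimes\mathfrak h_2)\to L(\mathfrak h)$ be the partial trace, i.e. the linear map with $\operatorname{Tr}_{\mathfrak h_2}(A\otimes B)=\operatorname{Tr}(B)\,A$. For an orthonormal basis $(e_j)$ of eigenvectors of $\hat\rho_\beta$ let $\mathcal T$ be the partial transpose, i.e. the linear map on $L(\mathfrak h\otimes\mathfrak h_2)$ with $\mathcal T(A\otimes|e_j\rangle\langle e_k|)=A\otimes|e_k\rangle\langle e_j|$, and let $$\mathcal Y_{\hat\rho_\beta}\mathbb Q=(\mathbf 1\otimes\hat\rho_\beta^{1/2})\,(\mathcal T\mathbb Q)\,(\mathbf 1\otimes\hat\rho_\beta^{1/2}).$$ **Theorem.** Let $\mathcal L$ be a Lindblad operator on $L(\mathfrak h)$ that satisfies the DBC with respect to $\hat\rho_\beta$. Then there is a Hermitian operator $\mathbb Q$ on $\mathfrak h\otimes\mathfrak h_2$ with $[\mathbb Q,\hat\rho_\beta\otimes\hat\rho_\beta]=0$ such that $$\mathcal L\rho=-\operatorname{Tr}_{\mathfrak h_2}\big[\mathbb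 Q,[\mathbb Q,\rho\otimes\hat\rho_\beta]\big]\quad\text{for all }\rho\in L(\mathfrak h).\tag{1}$$ Moreover, let $\mathbb Q$ be any Hermitian operator on $\mathfrak h\otimes\mathfrak h_2$ with $[\mathbb Q,\hat\rho_\beta\otimes\hat\rho_\beta]=0$, let $(e_j)$ be any orthonormal eigenbasis of $\hat\rho_\beta$, and let $\tilde{\mathbb Q}=\mathcal Y_{\hat\rho_\beta}\mathbb Q$. Then (1) holds if and only if $$\mathcal L\rho=-\operatorname{Tr}_{\mathfrak h_2}\big[\tilde{\mathbb Q},[\tilde{\mathbb Q},\rho\otimes\hat\rho_\beta^{-1}]\big]\quad\text{for all }\rho\in L(\mathfrak h).\tag{2}$$ In particular, $\mathcal L$ has both representations. -/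

import Mathlib

open scoped TensorProduct ComplexOrder

namespace DBCLindblad

noncomputable section

/-- The algebra `L(E)` of operators on a (finite-dimensional) complex Hilbert space. -/
abbrev Op (E : Type*) [NormedAddCommGroup E] [InnerProductSpace ℂ E] : Type _ :=
  Module.End ℂ E

section OneSpace

variable {E : Type*} [NormedAddCommGroup E] [InnerProductSpace ℂ E] [FiniteDimensional ℂ E]

/-- The Hilbert–Schmidt scalar product `⟪A, B⟫ = Tr (A* B)`. -/
def hs (A B : Op E) : ℂ := LinearMap.trace ℂ E (LinearMap.adjoint A * B)

/-- The matrix unit `|b i⟩⟨b j|` of a fixed orthonormal basis `b` of `E`. -/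
def matUnit (i j : Fin (Module.finrank ℂ E)) : Op E :=
  (InnerProductSpace.rankOne ℂ (stdOrthonormalBasis ℂ E i) (stdOrthonormalBasis ℂ E j)).toLinearMap

/-- The adjoint `L*` of a superoperator `L` with respect to the Hilbert–Schmidt scalar product,
written out in an orthonormal basis of matrix units. See `hs_hsAdjoint` for the defining
property, and `eq_hsAdjoint` for uniqueness. -/
def hsAdjoint (L : Op E →ₗ[ℂ] Op E) (A : Op E) : Op E :=
  ∑ i, ∑ j, hs (L (matUnit i j)) A • matUnit i j

theorem hs_eq_sum (A B : Op E) :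
    hs A B = ∑ i, inner ℂ (A (stdOrthonormalBasis ℂ E i)) (B (stdOrthonormalBasis ℂ E i)) := by
  rw [hs, LinearMap.trace_eq_sum_inner _ (stdOrthonormalBasis ℂ E)]
  simp [Module.End.mul_apply, LinearMap.adjoint_inner_right]

theorem hs_conj (A B : Op E) : (starRingEnd ℂ) (hs A B) = hs B A := by
  simp [hs_eq_sum, map_sum, inner_conj_symm]

theorem hs_sum_smul {κ : Type*} (s : Finset κ) (A : Op E) (c : κ → ℂ) (B : κ → Op E) :
    hs A (∑ k ∈ s, c k • B k) = ∑ k ∈ s, c k * hs A (B k) := by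
  simp [hs, Finset.mul_sum]

theorem sum_hs_matUnit (B : Op E) : ∑ i, ∑ j, hs (matUnit i j) B • matUnit i j = B := by
  apply (stdOrthonormalBasis ℂ E).toBasis.ext
  intro k
  have h : ∀ i j, hs (matUnit i j) B =
      inner ℂ (stdOrthonormalBasis ℂ E i) (B (stdOrthonormalBasis ℂ E j)) := by
    intro i j
    rw [hs_eq_sum, Finset.sum_eq_single j]
    · simp [matUnit]
    · intro x _ hx
      simp [matUnit, hx.symm]
    · simp
  simp only [h]
  simp [matUnit, OrthonormalBasis.inner_eq_ite, LinearMap.sum_apply, ite_smul,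
    OrthonormalBasis.sum_repr']

/-- The defining property `⟪L* A, B⟫ = ⟪A, L B⟫` of the adjoint. -/
theorem hs_hsAdjoint (L : Op E →ₗ[ℂ] Op E) (A B : Op E) :
    hs (hsAdjoint L A) B = hs A (L B) := by
  conv_rhs => rw [← sum_hs_matUnit B]
  rw [← hs_conj, hsAdjoint]
  simp only [← Finset.sum_product', map_sum, map_smul, hs_sum_smul, map_mul, hs_conj]
  exact Finset.sum_congr rfl fun _ _ => mul_comm _ _

/-- The Hilbert–Schmidt adjoint is the only map with the defining property. -/
theorem eq_hsAdjoint (L : Op E →ₗ[ℂ] Op E) (M : Op E → Op E)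
    (hM : ∀ A B, hs (M A) B = hs A (L B)) : M = hsAdjoint L := by
  funext A
  rw [← sum_hs_matUnit (M A), ← sum_hs_matUnit (hsAdjoint L A)]
  refine Finset.sum_congr rfl fun i _ => Finset.sum_congr rfl fun j _ => ?_
  rw [← hs_conj (M A), ← hs_conj (hsAdjoint L A), hM, hs_hsAdjoint]

/-- `L` is a Lindblad operator: `L A = ∑ₙₘ aₙₘ ([Qₙ, A Qₘ*] + [Qₙ A, Qₘ*])` for arbitrary operators
`Qₙ` and a Hermitian positive semidefinite matrix `a` (any finite number of terms is allowed). -/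
def IsLindblad (L : Op E →ₗ[ℂ] Op E) : Prop :=
  ∃ (k : ℕ) (a : Matrix (Fin k) (Fin k) ℂ) (Q : Fin k → Op E), a.PosSemidef ∧
    ∀ A : Op E, L A = ∑ n, ∑ m, a n m •
      (⁅Q n, A * LinearMap.adjoint (Q m)⁆ + ⁅Q n * A, LinearMap.adjoint (Q m)⁆)

/-- The detailed balance condition for `L` with respect to `ρ`. -/
def IsDBC (L : Op E →ₗ[ℂ] Op E) (ρ : Op E) : Prop :=
  L ρ = 0 ∧ ∀ A B : Op E, hs (hsAdjoint L A) (B * ρ) = hs A (hsAdjoint L B * ρ)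

/-- The operator `exp (-β H)`. -/
def expOp (β : ℝ) (H : Op E) : Op E :=
  (NormedSpace.exp ((-β : ℂ) • LinearMap.toContinuousLinearMap H)).toLinearMap

/-- The equilibrium state `Z⁻¹ exp (-β H)`, where `Z = Tr exp (-β H)`. -/
def gibbs (β : ℝ) (H : Op E) : Op E :=
  (LinearMap.trace ℂ E (expOp β H))⁻¹ • expOp β H

/-- The positive square root `σ ^ (1/2)` of a positive semidefinite operator. -/
def sqrtOp (σ : Op E) : Op E :=
  (CFC.sqrt (LinearMap.toContinuousLinearMap σ)).toLinearMap

/-- The transpose of `B` in the orthonormal basis `e`: the linear map with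
`|e j⟩⟨e k| ↦ |e k⟩⟨e j|`. -/
def transposeOp {ι : Type*} [Fintype ι] [DecidableEq ι] (e : OrthonormalBasis ι ℂ E) :
    Op E →ₗ[ℂ] Op E :=
  (Matrix.toLin e.toBasis e.toBasis).toLinearMap ∘ₗ
    (Matrix.transposeLinearEquiv ι ι ℂ ℂ).toLinearMap ∘ₗ
    (LinearMap.toMatrix e.toBasis e.toBasis).toLinearMap

theorem transposeOp_rankOne {ι : Type*} [Fintype ι] [DecidableEq ι]
    (e : OrthonormalBasis ι ℂ E) (j k : ι) :
    transposeOp e (InnerProductSpace.rankOne ℂ (e j) (e k)).toLinearMap =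
      (InnerProductSpace.rankOne ℂ (e k) (e j)).toLinearMap := by
  apply (LinearMap.toMatrix e.toBasis e.toBasis).injective
  simp only [transposeOp, LinearMap.comp_apply, LinearEquiv.coe_toLinearMap,
    LinearMap.toMatrix_toLin]
  ext a b
  change LinearMap.toMatrix e.toBasis e.toBasis _ b a = _
  simp only [LinearMap.toMatrix_apply]
  simp [OrthonormalBasis.repr_apply_apply, OrthonormalBasis.inner_eq_ite]
  split_ifs <;> simp_all [OrthonormalBasis.inner_eq_ite, eq_comm]

/-- `e` is an orthonormal basis of eigenvectors of `σ`. -/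
def IsEigenbasis {ι : Type*} [Fintype ι] (e : OrthonormalBasis ι ℂ E) (σ : Op E) : Prop :=
  ∀ j, ∃ c : ℂ, σ (e j) = c • e j

end OneSpace

section TwoSpaces

variable {E F : Type*} [NormedAddCommGroup E] [InnerProductSpace ℂ E] [FiniteDimensional ℂ E]
  [NormedAddCommGroup F] [InnerProductSpace ℂ F] [FiniteDimensional ℂ F]

/-- The partial trace over the second factor: the linear map with `A ⊗ B ↦ Tr(B) A`. -/
def partialTrace : Op (E ⊗[ℂ] F) →ₗ[ℂ] Op E :=
  (TensorProduct.rid ℂ (Op E)).toLinearMap ∘ₗ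
    TensorProduct.map LinearMap.id (LinearMap.trace ℂ F) ∘ₗ
    (homTensorHomEquiv ℂ E F E F).symm.toLinearMap

theorem partialTrace_map (A : Op E) (B : Op F) :
    partialTrace (TensorProduct.map A B) = LinearMap.trace ℂ F B • A := by
  have h : (homTensorHomEquiv ℂ E F E F).symm (TensorProduct.map A B) = A ⊗ₜ[ℂ] B := by
    rw [LinearEquiv.symm_apply_eq, homTensorHomEquiv_apply, TensorProduct.homTensorHomMap_apply]
  simp [partialTrace, h]

/-- The partial transpose on the second factor: the linear map with `A ⊗ B ↦ A ⊗ Bᵀ`, where `ᵀ` is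
the transpose in the basis `e`. -/
def partialTranspose {ι : Type*} [Fintype ι] [DecidableEq ι] (e : OrthonormalBasis ι ℂ F) :
    Op (E ⊗[ℂ] F) →ₗ[ℂ] Op (E ⊗[ℂ] F) :=
  (homTensorHomEquiv ℂ E F E F).toLinearMap ∘ₗ
    TensorProduct.map LinearMap.id (transposeOp e) ∘ₗ
    (homTensorHomEquiv ℂ E F E F).symm.toLinearMap

theorem partialTranspose_map {ι : Type*} [Fintype ι] [DecidableEq ι]
    (e : OrthonormalBasis ι ℂ F) (A : Op E) (B : Op F) :
    partialTranspose e (TensorProduct.map A B) = TensorProduct.map A (transposeOp e B) := by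
  have h : (homTensorHomEquiv ℂ E F E F).symm (TensorProduct.map A B) = A ⊗ₜ[ℂ] B := by
    rw [LinearEquiv.symm_apply_eq, homTensorHomEquiv_apply, TensorProduct.homTensorHomMap_apply]
  simp [partialTranspose, h, TensorProduct.homTensorHomMap_apply]

/-- The operator `𝒴_σ Q = (1 ⊗ σ^(1/2)) (𝒯 Q) (1 ⊗ σ^(1/2))`, where `𝒯` is the partial transpose
in the orthonormal eigenbasis `e` of `σ`. -/
def dualOp {ι : Type*} [Fintype ι] [DecidableEq ι] (e : OrthonormalBasis ι ℂ F) (σ : Op F)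
    (Q : Op (E ⊗[ℂ] F)) : Op (E ⊗[ℂ] F) :=
  TensorProduct.map (1 : Op E) (sqrtOp σ) * partialTranspose e Q *
    TensorProduct.map (1 : Op E) (sqrtOp σ)

/-- `L A = -Tr₂ [Q, [Q, A ⊗ σ]]` for all `A`. -/
def IsCompactRep (L : Op E →ₗ[ℂ] Op E) (Q : Op (E ⊗[ℂ] F)) (σ : Op F) : Prop :=
  ∀ A : Op E, L A = -partialTrace ⁅Q, ⁅Q, (TensorProduct.map A σ : Op (E ⊗[ℂ] F))⁆⁆

end TwoSpaces

end

end DBCLindblad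

/-! In an eigenbasis of the Gibbs state, that state is `diag p` with all `p i > 0`, and a Lindblad
operator is encoded by a positive semidefinite matrix `C` indexed by pairs. `C` is not unique, so
detailed balance constrains only the entries of the superoperator. Together with preservation of
adjoints it makes the entry `z w x y` vanish unless `p z / p x = p w / p y`. Hence `C` can be
pinched to the level sets of this ratio without changing the superoperator, and the pinched matrix
itself is balanced (`exists_balanced_coeff`).

By `isCompactRep_iff`, a double commutator with weight `diag s` has coefficient matrix `repCoeff s
Q`, quadratic in `Q`, so existence amounts to solving `repCoeff p Q = C`. A solution is `√C` with
its indices reshuffled and one weight divided out (`exists_repCoeff`). It is Hermitian because `√C`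
inherits the balance of `C` (`sqrt_swap`), and it commutes with `diag p ⊗ diag p` because `√C` is
block diagonal.

The duality is an identity of coefficients (`repCoeff_dualOp`): partial transposition exchanges the
two summation indices, and the square root weights turn `p⁻¹` into `p`. -/

namespace DBCLindblad

open Matrix

/-! ### Coefficient matrices of Lindblad operators and detailed balance -/

section MatrixLindblad

variable {ι : Type*} [Fintype ι] [DecidableEq ι]

/-- The operator `∑ z, C (z, ·) (z, ·)` of the anticommutator term of the Lindblad operator with
coefficient matrix `C`. -/
def dissipator (C : Matrix (ι × ι) (ι × ι) ℂ) : Matrix ι ι ℂ :=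
  Matrix.of fun y x => ∑ z, C (z, x) (z, y)

/-- The entry `(z, w)` of the image of the matrix unit `(x, y)` under the Lindblad operator with
coefficient matrix `C`. -/
def lindbladEntry (C : Matrix (ι × ι) (ι × ι) ℂ) (z w x y : ι) : ℂ :=
  2 * C (z, x) (w, y) - (if y = w then dissipator C z x else 0) -
    (if z = x then dissipator C y w else 0)

/-- The Lindblad operator with coefficient matrix `C`, acting on matrices. -/
def lindbladMatrix (C : Matrix (ι × ι) (ι × ι) ℂ) (A : Matrix ι ι ℂ) : Matrix ι ι ℂ :=
  Matrix.of fun z w => ∑ x, ∑ y, lindbladEntry C z w x y * A x y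

theorem dissipator_conj {ι : Type*} [Fintype ι] {C : Matrix (ι × ι) (ι × ι) ℂ} (hC : C.IsHermitian) (y x : ι) :
    star (dissipator C y x) = dissipator C x y := by
  simp only [dissipator, Matrix.of_apply, star_sum]
  exact Finset.sum_congr rfl fun z _ => hC.apply _ _

/-- For Hermitian `C` the superoperator preserves adjoints. This supplies a second detailed balance
relation for each entry. -/
theorem lindbladEntry_conj {C : Matrix (ι × ι) (ι × ι) ℂ} (hC : C.IsHermitian) (z w x y : ι) :
    star (lindbladEntry C z w x y) = lindbladEntry C w z y x := by
  simp only [lindbladEntry, star_sub, star_mul', hC.apply, apply_ite star, star_zero,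
    dissipator_conj hC, star_ofNat]
  rw [sub_right_comm]
  simp only [eq_comm]

theorem lindbladMatrix_apply (C : Matrix (ι × ι) (ι × ι) ℂ) (A : Matrix ι ι ℂ) (z w : ι) :
    lindbladMatrix C A z w = 2 * ∑ x, ∑ y, C (z, x) (w, y) * A x y
      - (dissipator C * A) z w - (A * dissipator C) z w := by
  simp only [lindbladMatrix, lindbladEntry, Matrix.of_apply, sub_mul, Finset.sum_sub_distrib,
    Finset.mul_sum, Matrix.mul_apply, mul_assoc, ite_mul, zero_mul]
  congr 1
  · simp
  · rw [Finset.sum_comm]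
    simp [mul_comm]

theorem lindbladMatrix_single (C : Matrix (ι × ι) (ι × ι) ℂ) (z w x y : ι) :
    lindbladMatrix C (Matrix.single x y 1) z w = lindbladEntry C z w x y := by
  simp [lindbladMatrix, Matrix.single_apply, ite_and]

/-- The part of `C` that is diagonal with respect to the level sets of `r`. -/
def pinching {n α : Type*} [DecidableEq α] (r : n → α) (C : Matrix n n ℂ) : Matrix n n ℂ :=
  Matrix.of fun i j => if r i = r j then C i j else 0

theorem posSemidef_pinching {n α : Type*} [Fintype n] [DecidableEq n] [DecidableEq α] (r : n → α)
    {C : Matrix n n ℂ} (hC : C.PosSemidef) : (pinching r C).PosSemidef := by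
  have h := hC.hadamard ((Matrix.PosSemidef.one (n := α) (R := ℂ)).submatrix r)
  have e : pinching r C = C ⊙ (1 : Matrix α α ℂ).submatrix r r := by
    ext i j
    simp [pinching, Matrix.one_apply]
  rw [e]
  exact h

/-- Existence of a coefficient matrix adapted to the detailed balance condition. -/
theorem exists_balanced_coeff {p : ι → ℝ} (hp : ∀ i, 0 < p i) {C : Matrix (ι × ι) (ι × ι) ℂ}
    (hC : C.PosSemidef)
    (hb : ∀ z w x y, (p y : ℂ) * lindbladEntry C z w x y = p w * star (lindbladEntry C x y z w)) :
    ∃ C' : Matrix (ι × ι) (ι × ι) ℂ, C'.PosSemidef ∧ lindbladEntry C' = lindbladEntry C ∧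
      (∀ i j, p i.1 / p i.2 ≠ p j.1 / p j.2 → C' i j = 0) ∧
      ∀ i j, (p j.2 : ℂ) * C' i j = p j.1 * star (C' i.swap j.swap) := by
  -- Balance for an entry and for its conjugate involve the same two numbers; eliminating `star
  -- (lindbladEntry C x y z w)` leaves `p z * p y = p w * p x` or a zero entry.
  have hzero : ∀ z w x y, p z / p x ≠ p w / p y → lindbladEntry C z w x y = 0 := by
    intro z w x y hne
    have h1 := hb z w x y
    have h2 := hb w z y x
    rw [← lindbladEntry_conj hC.isHermitian z w x y, ← lindbladEntry_conj hC.isHermitian x y z w,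
      star_star] at h2
    have h3 := congrArg star h2
    simp only [star_mul', RCLike.star_def, Complex.conj_ofReal, Complex.conj_conj] at h1 h3
    by_contra hl
    apply hne
    have hz := (hp z).ne'; have hx := (hp x).ne'; have hw := (hp w).ne'; have hy := (hp y).ne'
    rw [div_eq_div_iff hx hy]
    have h4 : ((p z * p y : ℝ) : ℂ) * lindbladEntry C z w x y
        = ((p w * p x : ℝ) : ℂ) * lindbladEntry C z w x y := by
      push_cast
      linear_combination (p z : ℂ) * h1 - (p w : ℂ) * h3
    exact_mod_cast mul_right_cancel₀ hl h4
  let r : ι × ι → ℝ := fun i => p i.1 / p i.2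
  have hK : ∀ y x, dissipator (pinching r C) y x = if p x = p y then dissipator C y x else 0 := by
    intro y x
    have : ∀ z, p z / p x = p z / p y ↔ p x = p y := fun z => by
      rw [div_eq_div_iff (hp x).ne' (hp y).ne']
      constructor
      · intro h; exact (mul_left_cancel₀ (hp z).ne' h).symm
      · intro h; rw [h]
    simp only [dissipator, pinching, Matrix.of_apply, r, this]
    split_ifs <;> simp
  -- At equal ratios each Kronecker delta forces the equality under which `hK` keeps the dissipator
  -- entry; at unequal ratios it forces the opposite, so every term vanishes, in agreement with
  -- `hzero`.
  have hent : lindbladEntry (pinching r C) = lindbladEntry C := by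
    funext z w x y
    by_cases h : p z / p x = p w / p y
    · have e1 : y = w → p x = p z := by
        rintro rfl
        have := (hp y).ne'; have := (hp x).ne'
        field_simp at h
        exact h.symm
      have e2 : z = x → p w = p y := by
        rintro rfl
        have := (hp y).ne'; have := (hp z).ne'
        field_simp at h
        exact h.symm
      simp only [lindbladEntry, hK]
      congr 1
      · congr 1
        · simp [pinching, r, h]
        · split_ifs <;> simp_all
      · split_ifs <;> simp_all
    · rw [hzero z w x y h]
      have e1 : y = w → p x ≠ p z := by
        rintro rfl h'
        rw [h'] at h; exact h (by rw [div_self (hp z).ne', div_self (hp y).ne'])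
      have e2 : z = x → p w ≠ p y := by
        rintro rfl h'
        rw [h'] at h; exact h (by rw [div_self (hp z).ne', div_self (hp y).ne'])
      simp only [lindbladEntry, hK]
      have : pinching r C (z, x) (w, y) = 0 := by simp [pinching, r, h]
      rw [this]
      split_ifs <;> simp_all
  have hP := posSemidef_pinching r hC
  refine ⟨pinching r C, hP, hent, fun i j h => by simp [pinching, r, h], ?_⟩
  rintro ⟨z, x⟩ ⟨w, y⟩
  have h := hb z w x y
  rw [← hent] at h
  -- The pinched dissipator commutes with `diag p`, so the two delta terms are balanced on their own
  -- and cancel, which leaves the balance of the coefficients.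
  have hK0 : ∀ y x, (p y : ℂ) * dissipator (pinching r C) y x
      = p x * dissipator (pinching r C) y x := by
    intro y x
    rw [hK]
    split_ifs with h' <;> simp [h']
  simp only [lindbladEntry, star_sub, star_mul', apply_ite star, star_zero, star_ofNat,
    dissipator_conj hP.isHermitian] at h
  have t2 : (p y : ℂ) * (if y = w then dissipator (pinching r C) z x else 0)
      = p w * (if w = y then dissipator (pinching r C) z x else 0) := by
    by_cases e : y = w
    · simp [e]
    · simp [e, Ne.symm e]
  have t3 : (p y : ℂ) * (if z = x then dissipator (pinching r C) y w else 0)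
      = p w * (if x = z then dissipator (pinching r C) y w else 0) := by
    by_cases e : z = x
    · simp [e, hK0]
    · simp [e, Ne.symm e]
  simp only [Prod.swap]
  linear_combination (h + t2 + t3) / 2

end MatrixLindblad

/-! ### Square roots of balanced matrices and the equation `repCoeff p Q = C` -/

section MatrixSqrt

open scoped MatrixOrder

/-- The square root of a matrix that is block diagonal with respect to the level sets of `r` is
block diagonal. -/
theorem sqrt_apply_eq_zero {n : Type*} [Fintype n] [DecidableEq n] {r : n → ℝ}
    {C : Matrix n n ℂ} (hr : ∀ i j, r i ≠ r j → C i j = 0) {i j : n} (hij : r i ≠ r j) :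
    CFC.sqrt C i j = 0 := by
  have hcomm : Commute C (Matrix.diagonal fun i => (r i : ℂ)) := by
    ext i j
    rw [Matrix.mul_diagonal, Matrix.diagonal_mul]
    by_cases h : r i = r j
    · rw [h, mul_comm]
    · simp [hr i j h]
  -- Block diagonality is commutation with `diag r`, which passes to anything in the functional
  -- calculus of `C`.
  have h := congrFun₂ (hcomm.cfcₙ_nnreal NNReal.sqrt).eq i j
  change (CFC.sqrt C * Matrix.diagonal fun i => (r i : ℂ) : Matrix n n ℂ) i j
    = ((Matrix.diagonal fun i => (r i : ℂ)) * CFC.sqrt C : Matrix n n ℂ) i j at h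
  rw [Matrix.mul_diagonal, Matrix.diagonal_mul] at h
  have h' : ((r j : ℂ) - r i) * CFC.sqrt C i j = 0 := by linear_combination h
  refine (mul_eq_zero.mp h').resolve_left fun h0 => hij ?_
  exact_mod_cast (sub_eq_zero.mp h0).symm

/-- The symmetry of the coefficient matrix that expresses detailed balance passes to the square
root. -/
theorem sqrt_swap {ι : Type*} [Fintype ι] [DecidableEq ι] {p : ι → ℝ} (hp : ∀ i, 0 < p i)
    {C : Matrix (ι × ι) (ι × ι) ℂ} (hC : C.PosSemidef)
    (hr : ∀ i j, p i.1 / p i.2 ≠ p j.1 / p j.2 → C i j = 0)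
    (hs : ∀ i j, (p j.2 : ℂ) * C i j = p j.1 * star (C i.swap j.swap)) (i j : ι × ι) :
    ((√(p j.2) : ℝ) : ℂ) * CFC.sqrt C i j
      = ((√(p j.1) : ℝ) : ℂ) * star (CFC.sqrt C i.swap j.swap) := by
  set R := CFC.sqrt C with hR
  have hRR : R * R = C := CFC.sqrt_mul_sqrt_self C hC.nonneg
  have hRp : R.PosSemidef := (CFC.sqrt_nonneg C).posSemidef
  have hr0 : ∀ i j : ι × ι, p i.1 / p i.2 ≠ p j.1 / p j.2 → R i j = 0 := fun i j h =>
    sqrt_apply_eq_zero (r := fun i : ι × ι => p i.1 / p i.2) hr h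
  -- A fourth root: on a block, `D * R * D` scales `R` by `t ^ 2` and its square scales `C` by `t ^
  -- 4`, which must be `p j.2 / p j.1`.
  let t : ι × ι → ℝ := fun i => √(√(p i.2 / p i.1))
  have ht : ∀ i j : ι × ι, p i.1 / p i.2 = p j.1 / p j.2 → t i = t j := fun i j h => by
    simp only [t]
    rw [← inv_div (p i.1), h, inv_div]
  let D : Matrix (ι × ι) (ι × ι) ℂ := Matrix.diagonal fun i => (t i : ℂ)
  have hD : Dᴴ = D := by
    simp only [D, Matrix.diagonal_conjTranspose]
    congr 1
    ext i
    simp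
  have hcomm : R * D = D * R := by
    ext i j
    simp only [D, Matrix.mul_diagonal, Matrix.diagonal_mul]
    by_cases h : p i.1 / p i.2 = p j.1 / p j.2
    · rw [ht i j h, mul_comm]
    · simp [hr0 i j h]
  let N := D * R * D
  have hN : N.PosSemidef := by
    have := hRp.conjTranspose_mul_mul_same D
    rwa [hD] at this
  let S : Matrix (ι × ι) (ι × ι) ℂ := (Rᵀ).submatrix Prod.swap Prod.swap
  have hS : S.PosSemidef := hRp.transpose.submatrix _
  have hSapp : ∀ i j, S i j = star (R i.swap j.swap) := fun i j =>
    (hRp.isHermitian.apply _ _).symm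
  have hNN : N * N = D * D * C * (D * D) := by
    rw [← hRR]
    simp only [N]
    calc D * R * D * (D * R * D) = D * (R * D) * (D * R) * D := by simp only [mul_assoc]
      _ = D * (D * R) * (R * D) * D := by rw [hcomm]
      _ = _ := by simp only [mul_assoc]
  have hSS : S * S = N * N := by
    have h1 : S * S = (Cᵀ).submatrix Prod.swap Prod.swap := by
      rw [← hRR, Matrix.transpose_mul]
      exact (Matrix.submatrix_mul_equiv Rᵀ Rᵀ Prod.swap (Equiv.prodComm ι ι) Prod.swap)
    rw [h1, hNN]
    ext i j
    have h2 : (D * D * C * (D * D)) i j = ((t i * t i * (t j * t j) : ℝ) : ℂ) * C i j := by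
      simp only [D, Matrix.diagonal_mul_diagonal, Matrix.mul_diagonal, Matrix.diagonal_mul]
      push_cast
      ring
    rw [h2, Matrix.submatrix_apply, Matrix.transpose_apply, ← hC.isHermitian.apply]
    by_cases h : p i.1 / p i.2 = p j.1 / p j.2
    · rw [ht i j h]
      have h3 : t j * t j * (t j * t j) = p j.2 / p j.1 := by
        have h4 := (div_pos (hp j.2) (hp j.1)).le
        simp only [t]
        rw [Real.mul_self_sqrt (Real.sqrt_nonneg _), Real.mul_self_sqrt h4]
      rw [h3]
      have h5 : (p j.1 : ℂ) ≠ 0 := by exact_mod_cast (hp j.1).ne'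
      push_cast
      field_simp
      rw [hs i j, mul_comm]
    · rw [hr i j h, hr i.swap j.swap]
      · simp
      · intro h'
        apply h
        simp only [Prod.fst_swap, Prod.snd_swap] at h'
        rw [← inv_div (p i.2), h', inv_div]
  -- Both are positive semidefinite square roots of the same matrix.
  have hSN : S = N := by
    rw [← CFC.sqrt_unique rfl hS.nonneg, hSS, CFC.sqrt_unique rfl hN.nonneg]
  rw [← hSapp, hSN]
  have h6 : N i j = ((t i * t j : ℝ) : ℂ) * R i j := by
    simp only [N, D, Matrix.mul_diagonal, Matrix.diagonal_mul]
    push_cast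
    ring
  rw [h6]
  by_cases h : p i.1 / p i.2 = p j.1 / p j.2
  · rw [ht i j h, ← mul_assoc]
    congr 1
    have h7 : t j * t j = √(p j.2) / √(p j.1) := by
      simp only [t]
      rw [Real.mul_self_sqrt (Real.sqrt_nonneg _), Real.sqrt_div' _ (hp j.1).le]
    have h8 : √(p j.1) ≠ 0 := (Real.sqrt_pos.mpr (hp j.1)).ne'
    rw [h7, ← Complex.ofReal_mul]
    congr 1
    field_simp
  · simp [hr0 i j h]

/-- The coefficient matrix of the superoperator `A ↦ -Tr₂ [Q, [Q, A ⊗ diag s]]`. -/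
def repCoeff {ι : Type*} [Fintype ι] (s : ι → ℂ) (Q : Matrix (ι × ι) (ι × ι) ℂ) :
    Matrix (ι × ι) (ι × ι) ℂ :=
  Matrix.of fun i j => ∑ a, ∑ b, s b * Q (i.1, a) (i.2, b) * Q (j.2, b) (j.1, a)

/-- A coefficient matrix with the detailed balance symmetry comes from a Hermitian matrix that
commutes with `diag p ⊗ diag p`. -/
theorem exists_repCoeff {ι : Type*} [Fintype ι] [DecidableEq ι] {p : ι → ℝ} (hp : ∀ i, 0 < p i)
    {C : Matrix (ι × ι) (ι × ι) ℂ} (hC : C.PosSemidef)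
    (hr : ∀ i j, p i.1 / p i.2 ≠ p j.1 / p j.2 → C i j = 0)
    (hs : ∀ i j, (p j.2 : ℂ) * C i j = p j.1 * star (C i.swap j.swap)) :
    ∃ Q : Matrix (ι × ι) (ι × ι) ℂ, Q.IsHermitian ∧
      (∀ i j, p i.1 * p i.2 ≠ p j.1 * p j.2 → Q i j = 0) ∧
      repCoeff (fun i => (p i : ℂ)) Q = C := by
  -- The first-factor indices of `Q` form the row of `√C`, the second-factor ones its column in
  -- reversed order. The two prefactors in `repCoeff` cancel the weight `p b`.
  let Q : Matrix (ι × ι) (ι × ι) ℂ := Matrix.of fun i j =>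
    ((√(p j.2) : ℝ) : ℂ)⁻¹ * CFC.sqrt C (i.1, j.1) (j.2, i.2)
  have h0 : ∀ a, ((√(p a) : ℝ) : ℂ) ≠ 0 := fun a => by
    exact_mod_cast (Real.sqrt_pos.mpr (hp a)).ne'
  have hQ : Q.IsHermitian := by
    ext ⟨x, a⟩ ⟨y, b⟩
    have h1 := sqrt_swap hp hC hr hs (x, y) (b, a)
    have ha := h0 a
    have hb := h0 b
    simp only [Q, Matrix.conjTranspose_apply, Matrix.of_apply, star_mul', star_inv₀,
      Prod.swap] at h1 ⊢
    rw [show star ((√(p a) : ℝ) : ℂ) = ((√(p a) : ℝ) : ℂ) from Complex.conj_ofReal _]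
    field_simp
    linear_combination -h1
  refine ⟨Q, hQ, ?_, ?_⟩
  · rintro ⟨x, a⟩ ⟨y, b⟩ h
    have : CFC.sqrt C (x, y) (b, a) = 0 := by
      apply sqrt_apply_eq_zero (r := fun i : ι × ι => p i.1 / p i.2) hr
      intro h'
      apply h
      simp only at h' ⊢
      rw [div_eq_div_iff (hp y).ne' (hp a).ne'] at h'
      rw [h', mul_comm]
    simp [Q, this]
  · ext ⟨z, x⟩ ⟨w, y⟩
    have hRR : CFC.sqrt C * CFC.sqrt C = C := CFC.sqrt_mul_sqrt_self C hC.nonneg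
    have hRp : (CFC.sqrt C).PosSemidef := (CFC.sqrt_nonneg C).posSemidef
    conv_rhs => rw [← hRR, Matrix.mul_apply, Fintype.sum_prod_type, Finset.sum_comm]
    simp only [repCoeff, Matrix.of_apply]
    refine Finset.sum_congr rfl fun a _ => Finset.sum_congr rfl fun b _ => ?_
    -- Hermiticity turns the second factor into the entry `(b, a) (w, y)` of `√C`, so the double sum
    -- is the product `√C * √C`.
    rw [← hQ.apply (y, b) (w, a), ← hRp.isHermitian.apply (b, a) (w, y)]
    have hb := h0 b
    simp only [Q, Matrix.of_apply, star_mul', star_inv₀]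
    rw [show star ((√(p b) : ℝ) : ℂ) = ((√(p b) : ℝ) : ℂ) from Complex.conj_ofReal _]
    have h2 : ((√(p b) : ℝ) : ℂ) * ((√(p b) : ℝ) : ℂ) = p b := by
      rw [← Complex.ofReal_mul, Real.mul_self_sqrt (hp b).le]
    rw [← h2]
    field_simp

end MatrixSqrt

/-! ### Translation between operators and matrices, and duality -/

section Coordinates

variable {E : Type*} [NormedAddCommGroup E] [InnerProductSpace ℂ E] [FiniteDimensional ℂ E]
  {ι : Type*} [Fintype ι] [DecidableEq ι]

/-- The matrix of an operator in an orthonormal basis. -/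
noncomputable def mat (e : OrthonormalBasis ι ℂ E) : Op E ≃ₐ[ℂ] Matrix ι ι ℂ :=
  LinearMap.toMatrixAlgEquiv e.toBasis

/-- The matrix of an operator on `E ⊗ E` in the product of an orthonormal basis with itself. -/
noncomputable def mat₂ (e : OrthonormalBasis ι ℂ E) :
    Op (E ⊗[ℂ] E) ≃ₐ[ℂ] Matrix (ι × ι) (ι × ι) ℂ :=
  LinearMap.toMatrixAlgEquiv (e.tensorProduct e).toBasis

theorem mat_adjoint (e : OrthonormalBasis ι ℂ E) (A : Op E) :
    mat e (LinearMap.adjoint A) = (mat e A)ᴴ :=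
  LinearMap.toMatrix_adjoint e e A

theorem mat₂_map (e : OrthonormalBasis ι ℂ E) (A B : Op E) (i j : ι × ι) :
    mat₂ e (TensorProduct.map A B) i j = mat e A i.1 j.1 * mat e B i.2 j.2 := by
  have h := congrFun₂ (TensorProduct.toMatrix_map e.toBasis e.toBasis e.toBasis e.toBasis A B) i j
  rw [← OrthonormalBasis.toBasis_tensorProduct] at h
  exact h

theorem mat₂_isHermitian_iff (e : OrthonormalBasis ι ℂ E) (Q : Op (E ⊗[ℂ] E)) :
    (mat₂ e Q).IsHermitian ↔ Q.IsSymmetric := by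
  rw [LinearMap.isSymmetric_iff_isSelfAdjoint, LinearMap.isSelfAdjoint_iff', Matrix.IsHermitian,
    ← (mat₂ e).injective.eq_iff]
  exact Eq.congr_left (LinearMap.toMatrix_adjoint (e.tensorProduct e) (e.tensorProduct e) Q).symm

theorem mat_transposeOp (e : OrthonormalBasis ι ℂ E) (B : Op E) :
    mat e (transposeOp e B) = (mat e B)ᵀ :=
  LinearMap.toMatrix_toLin e.toBasis e.toBasis (mat e B)ᵀ

theorem op_tensor_induction {P : Op (E ⊗[ℂ] E) → Prop} (h0 : P 0)
    (hmap : ∀ A B : Op E, P (TensorProduct.map A B)) (hadd : ∀ X Y, P X → P Y → P (X + Y))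
    (X : Op (E ⊗[ℂ] E)) : P X := by
  obtain ⟨T, rfl⟩ := (homTensorHomEquiv ℂ E E E E).surjective X
  induction T with
  | zero => simpa using h0
  | tmul A B =>
    rw [homTensorHomEquiv_apply, TensorProduct.homTensorHomMap_apply]
    exact hmap A B
  | add S T hS hT => rw [map_add]; exact hadd _ _ hS hT

theorem mat_partialTrace (e : OrthonormalBasis ι ℂ E) (X : Op (E ⊗[ℂ] E)) (z w : ι) :
    mat e (partialTrace X) z w = ∑ a, mat₂ e X (z, a) (w, a) := by
  induction X using op_tensor_induction with
  | h0 => simp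
  | hmap A B =>
    rw [partialTrace_map, LinearMap.trace_eq_matrix_trace ℂ e.toBasis]
    simp only [mat₂_map, map_smul, Matrix.smul_apply, Matrix.trace, smul_eq_mul, ← Finset.mul_sum]
    exact mul_comm _ _
  | hadd X Y hX hY => simp [hX, hY, Finset.sum_add_distrib]

theorem mat₂_partialTranspose (e : OrthonormalBasis ι ℂ E) (X : Op (E ⊗[ℂ] E)) (x a y b : ι) :
    mat₂ e (partialTranspose e X) (x, a) (y, b) = mat₂ e X (x, b) (y, a) := by
  induction X using op_tensor_induction with
  | h0 => simp
  | hmap A B => simp [partialTranspose_map, mat₂_map, mat_transposeOp]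
  | hadd X Y hX hY => simp [hX, hY]

theorem mat_eq_diagonal {e : OrthonormalBasis ι ℂ E} {S : Op E} {s : ι → ℂ}
    (hS : ∀ i, S (e i) = s i • e i) : mat e S = Matrix.diagonal s := by
  ext i j
  change LinearMap.toMatrix e.toBasis e.toBasis S i j = _
  rw [LinearMap.toMatrix_apply]
  by_cases h : i = j <;> simp [hS, h]

/-- The matrix of the superoperator defined by a compact representation. -/
theorem mat_partialTrace_commutator {e : OrthonormalBasis ι ℂ E} {S : Op E} {s : ι → ℂ}
    (hS : mat e S = Matrix.diagonal s) (Q : Op (E ⊗[ℂ] E)) (A : Op E) :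
    mat e (-partialTrace ⁅Q, ⁅Q, (TensorProduct.map A S : Op (E ⊗[ℂ] E))⁆⁆)
      = lindbladMatrix (repCoeff s (mat₂ e Q)) (mat e A) := by
  set q := mat₂ e Q with hq
  set a := mat e A with ha
  set X : Op (E ⊗[ℂ] E) := TensorProduct.map A S with hX
  have hXm : ∀ i j, mat₂ e X i j = if i.2 = j.2 then a i.1 j.1 * s j.2 else 0 := by
    intro i j
    rw [hX, mat₂_map, hS, Matrix.diagonal_apply]
    split_ifs with h
    · rw [h]
    · simp
  have hexp : ⁅Q, ⁅Q, X⁆⁆ = (Q * Q) * X - (2 : ℂ) • (Q * X * Q) + X * (Q * Q) := by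
    simp only [Ring.lie_def, two_smul]
    noncomm_ring
  have h1 : ∀ i j, (q * mat₂ e X) i j = ∑ x, q i (x, j.2) * (a x j.1 * s j.2) := by
    intro i j
    simp [Matrix.mul_apply, hXm, Fintype.sum_prod_type]
  have h1' : ∀ i j, (q * q * mat₂ e X) i j = ∑ x, (q * q) i (x, j.2) * (a x j.1 * s j.2) := by
    intro i j
    simp [Matrix.mul_apply (M := q * q), hXm, Fintype.sum_prod_type]
  have h2' : ∀ i j, (mat₂ e X * (q * q)) i j = ∑ y, a i.1 y * s i.2 * (q * q) (y, i.2) j := by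
    intro i j
    simp [Matrix.mul_apply (M := mat₂ e X), hXm, Fintype.sum_prod_type]
  -- The dissipator is the partial trace of `Q² (1 ⊗ S)`, so `repCoeff` accounts for the outer terms
  -- of `hexp` as well as for the sandwich term.
  have hK : ∀ y x, dissipator (repCoeff s q) y x = ∑ b, s b * (q * q) (y, b) (x, b) := by
    intro y x
    simp only [dissipator, repCoeff, Matrix.of_apply, Matrix.mul_apply, Fintype.sum_prod_type,
      Finset.mul_sum]
    rw [Finset.sum_congr rfl fun z _ => Finset.sum_comm, Finset.sum_comm]
    exact Finset.sum_congr rfl fun b _ => Finset.sum_congr rfl fun z _ =>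
      Finset.sum_congr rfl fun c _ => by ring
  ext z w
  rw [map_neg, Matrix.neg_apply, mat_partialTrace, hexp, lindbladMatrix_apply]
  simp only [map_add, map_sub, map_smul, map_mul, Matrix.add_apply, Matrix.sub_apply,
    Matrix.smul_apply, ← hq, Finset.sum_add_distrib, Finset.sum_sub_distrib, smul_eq_mul,
    ← Finset.mul_sum]
  have t1 : ∑ c, (q * q * mat₂ e X) (z, c) (w, c) = (dissipator (repCoeff s q) * a) z w := by
    simp only [h1', Matrix.mul_apply (M := dissipator _), hK, Finset.sum_mul]
    rw [Finset.sum_comm]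
    exact Finset.sum_congr rfl fun z _ => Finset.sum_congr rfl fun c _ => by ring
  have t2 : ∑ c, (mat₂ e X * (q * q)) (z, c) (w, c) = (a * dissipator (repCoeff s q)) z w := by
    simp only [h2', Matrix.mul_apply (M := a), hK, Finset.mul_sum]
    rw [Finset.sum_comm]
    exact Finset.sum_congr rfl fun z _ => Finset.sum_congr rfl fun c _ => by ring
  have t3 : ∑ c, (q * mat₂ e X * q) (z, c) (w, c)
      = ∑ x, ∑ y, repCoeff s q (z, x) (w, y) * a x y := by
    simp only [Matrix.mul_apply (N := q), h1, repCoeff, Matrix.of_apply, Fintype.sum_prod_type,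
      Finset.sum_mul]
    calc ∑ c, ∑ y, ∑ b, ∑ x, q (z, c) (x, b) * (a x y * s b) * q (y, b) (w, c)
        = ∑ c, ∑ x, ∑ y, ∑ b, q (z, c) (x, b) * (a x y * s b) * q (y, b) (w, c) := by
          refine Finset.sum_congr rfl fun c _ => ?_
          rw [Finset.sum_comm (s := (Finset.univ : Finset ι)) (t := Finset.univ)
            (f := fun x y => ∑ b, q (z, c) (x, b) * (a x y * s b) * q (y, b) (w, c))]
          exact Finset.sum_congr rfl fun y _ => Finset.sum_comm
      _ = ∑ x, ∑ y, ∑ c, ∑ b, q (z, c) (x, b) * (a x y * s b) * q (y, b) (w, c) := by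
          rw [Finset.sum_comm]
          exact Finset.sum_congr rfl fun x _ => Finset.sum_comm
      _ = _ := by
          refine Finset.sum_congr rfl fun x _ => Finset.sum_congr rfl fun y _ =>
            Finset.sum_congr rfl fun c _ => Finset.sum_congr rfl fun b _ => by ring
  rw [t1, t2, t3]
  ring

theorem isCompactRep_iff {e : OrthonormalBasis ι ℂ E} {S : Op E} {s : ι → ℂ}
    (hS : mat e S = Matrix.diagonal s) (L : Op E →ₗ[ℂ] Op E) (Q : Op (E ⊗[ℂ] E)) :
    IsCompactRep L Q S ↔
      ∀ A, mat e (L A) = lindbladMatrix (repCoeff s (mat₂ e Q)) (mat e A) := by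
  refine forall_congr' fun A => ?_
  rw [← (mat e).injective.eq_iff, mat_partialTrace_commutator hS]

/-- An operator that is diagonal in `e ⊗ e` up to a level set condition commutes with `S ⊗ S`. -/
theorem lie_map_eq_zero {e : OrthonormalBasis ι ℂ E} {S : Op E} {p : ι → ℝ}
    (hS : mat e S = Matrix.diagonal fun i => (p i : ℂ)) {Q : Op (E ⊗[ℂ] E)}
    (hQ : ∀ i j, p i.1 * p i.2 ≠ p j.1 * p j.2 → mat₂ e Q i j = 0) :
    ⁅Q, (TensorProduct.map S S : Op (E ⊗[ℂ] E))⁆ = 0 := by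
  have hd : mat₂ e (TensorProduct.map S S)
      = Matrix.diagonal fun i : ι × ι => ((p i.1 * p i.2 : ℝ) : ℂ) := by
    ext ⟨x, a⟩ ⟨y, b⟩
    rw [mat₂_map, hS]
    by_cases h1 : x = y <;> by_cases h2 : a = b <;> simp [h1, h2]
  apply (mat₂ e).injective
  rw [Ring.lie_def, map_sub, map_mul, map_mul, hd, map_zero]
  ext i j
  rw [Matrix.sub_apply, Matrix.mul_diagonal, Matrix.diagonal_mul, Matrix.zero_apply]
  by_cases h : p i.1 * p i.2 = p j.1 * p j.2
  · rw [h]; ring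
  · simp [hQ i j h]

theorem mat_ringInverse {e : OrthonormalBasis ι ℂ E} {S : Op E} {p : ι → ℝ}
    (hp : ∀ i, 0 < p i) (hS : mat e S = Matrix.diagonal fun i => (p i : ℂ)) :
    mat e (Ring.inverse S) = Matrix.diagonal fun i => (p i : ℂ)⁻¹ := by
  have h0 : ∀ i, (p i : ℂ) ≠ 0 := fun i => by exact_mod_cast (hp i).ne'
  have h1 : S * (mat e).symm (Matrix.diagonal fun i => (p i : ℂ)⁻¹) = 1 := by
    apply (mat e).injective
    rw [map_mul, AlgEquiv.apply_symm_apply, hS, Matrix.diagonal_mul_diagonal, map_one]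
    simp [h0]
  have h2 : (mat e).symm (Matrix.diagonal fun i => (p i : ℂ)⁻¹) * S = 1 := by
    apply (mat e).injective
    rw [map_mul, AlgEquiv.apply_symm_apply, hS, Matrix.diagonal_mul_diagonal, map_one]
    simp [h0]
  have := Ring.inverse_unit (⟨S, _, h1, h2⟩ : (Op E)ˣ)
  rw [show Ring.inverse S = (mat e).symm (Matrix.diagonal fun i => (p i : ℂ)⁻¹) from this,
    AlgEquiv.apply_symm_apply]

theorem mat_sqrtOp {e : OrthonormalBasis ι ℂ E} {S : Op E} {p : ι → ℝ}
    (hp : ∀ i, 0 < p i) (hS : mat e S = Matrix.diagonal fun i => (p i : ℂ)) :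
    mat e (sqrtOp S) = Matrix.diagonal fun i => ((√(p i) : ℝ) : ℂ) := by
  set T : Op E := (mat e).symm (Matrix.diagonal fun i => ((√(p i) : ℝ) : ℂ)) with hT
  have hTm : mat e T = Matrix.diagonal fun i => ((√(p i) : ℝ) : ℂ) := by
    rw [hT, AlgEquiv.apply_symm_apply]
  set U : Op E := (mat e).symm (Matrix.diagonal fun i => ((√(√(p i)) : ℝ) : ℂ)) with hU
  have hUm : mat e U = Matrix.diagonal fun i => ((√(√(p i)) : ℝ) : ℂ) := by
    rw [hU, AlgEquiv.apply_symm_apply]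
  have hTT : T * T = S := by
    apply (mat e).injective
    rw [map_mul, hTm, hS, Matrix.diagonal_mul_diagonal]
    congr 1
    ext i
    rw [← Complex.ofReal_mul, Real.mul_self_sqrt (hp i).le]
  have hUU : LinearMap.adjoint U * U = T := by
    apply (mat e).injective
    rw [map_mul, mat_adjoint, hUm, hTm, Matrix.diagonal_conjTranspose,
      Matrix.diagonal_mul_diagonal]
    congr 1
    ext i
    simp [← Complex.ofReal_mul]
  have hTp : 0 ≤ LinearMap.toContinuousLinearMap T := by
    rw [ContinuousLinearMap.nonneg_iff_isPositive, LinearMap.isPositive_toContinuousLinearMap_iff,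
      ← hUU]
    exact LinearMap.isPositive_adjoint_comp_self U
  -- Uniqueness needs `T` to be positive; the entrywise root `U` shows it as `U* U`.
  have h := CFC.sqrt_unique (a := LinearMap.toContinuousLinearMap S)
    (b := LinearMap.toContinuousLinearMap T) (by rw [← hTT]; rfl) hTp
  rw [sqrtOp, h]
  exact hTm

theorem mat₂_dualOp {e : OrthonormalBasis ι ℂ E} {S : Op E} {p : ι → ℝ}
    (hp : ∀ i, 0 < p i) (hS : mat e S = Matrix.diagonal fun i => (p i : ℂ))
    (Q : Op (E ⊗[ℂ] E)) (x a y b : ι) :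
    mat₂ e (dualOp e S Q) (x, a) (y, b)
      = ((√(p a) : ℝ) : ℂ) * mat₂ e Q (x, b) (y, a) * ((√(p b) : ℝ) : ℂ) := by
  have hd : mat₂ e (TensorProduct.map (1 : Op E) (sqrtOp S))
      = Matrix.diagonal fun i : ι × ι => ((√(p i.2) : ℝ) : ℂ) := by
    ext ⟨x, a⟩ ⟨y, b⟩
    rw [mat₂_map, mat_sqrtOp hp hS, map_one]
    by_cases h1 : x = y <;> by_cases h2 : a = b <;> simp [Matrix.one_apply, h1, h2]
  rw [dualOp, map_mul, map_mul, hd, Matrix.mul_diagonal, Matrix.diagonal_mul,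
    mat₂_partialTranspose]

/-- The two dual factors contribute `p a * p b`; the weight `(p b)⁻¹` leaves `p a`, and exchanging
`a` and `b` gives the original sum. -/
theorem repCoeff_dualOp {e : OrthonormalBasis ι ℂ E} {S : Op E} {p : ι → ℝ}
    (hp : ∀ i, 0 < p i) (hS : mat e S = Matrix.diagonal fun i => (p i : ℂ))
    (Q : Op (E ⊗[ℂ] E)) :
    repCoeff (fun i => (p i : ℂ)⁻¹) (mat₂ e (dualOp e S Q))
      = repCoeff (fun i => (p i : ℂ)) (mat₂ e Q) := by
  ext ⟨z, x⟩ ⟨w, y⟩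
  simp only [repCoeff, Matrix.of_apply, mat₂_dualOp hp hS]
  rw [Finset.sum_comm]
  refine Finset.sum_congr rfl fun b _ => Finset.sum_congr rfl fun a _ => ?_
  have hsq : ∀ c, ((√(p c) : ℝ) : ℂ) * ((√(p c) : ℝ) : ℂ) = p c := fun c => by
    rw [← Complex.ofReal_mul, Real.mul_self_sqrt (hp c).le]
  have hb : (p b : ℂ) ≠ 0 := by exact_mod_cast (hp b).ne'
  calc _ = (p b : ℂ)⁻¹ * (((√(p a) : ℝ) : ℂ) * ((√(p a) : ℝ) : ℂ)) *
        (((√(p b) : ℝ) : ℂ) * ((√(p b) : ℝ) : ℂ)) * mat₂ e Q (z, b) (x, a)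
          * mat₂ e Q (y, a) (w, b) := by ring
    _ = _ := by
      rw [hsq, hsq]
      field_simp

/-- The duality of compact representations. -/
theorem isCompactRep_dualOp_iff {e : OrthonormalBasis ι ℂ E} {S : Op E} {p : ι → ℝ}
    (hp : ∀ i, 0 < p i) (hS : mat e S = Matrix.diagonal fun i => (p i : ℂ))
    (L : Op E →ₗ[ℂ] Op E) (Q : Op (E ⊗[ℂ] E)) :
    IsCompactRep L Q S ↔ IsCompactRep L (dualOp e S Q) (Ring.inverse S) := by
  rw [isCompactRep_iff hS, isCompactRep_iff (mat_ringInverse hp hS), repCoeff_dualOp hp hS]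

end Coordinates

/-! ### Strict positivity of the Gibbs state -/

section Gibbs

variable {E : Type*} [NormedAddCommGroup E] [InnerProductSpace ℂ E] [FiniteDimensional ℂ E]

/-- The factor is `exp (-β H / 2)`, which is self-adjoint and invertible. -/
theorem expOp_eq_adjoint_mul_self (β : ℝ) {H : Op E} (hH : H.IsSymmetric) :
    ∃ T : Op E, IsUnit T ∧ expOp β H = LinearMap.adjoint T * T := by
  have : CompleteSpace E := FiniteDimensional.complete ℂ E
  let +nondep : NormedAlgebra ℚ (E →L[ℂ] E) := .restrictScalars ℚ ℂ (E →L[ℂ] E)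
  let K : E →L[ℂ] E := (-(β / 2) : ℂ) • LinearMap.toContinuousLinearMap H
  have hK : star K = K := by
    have hs : star (LinearMap.toContinuousLinearMap H) = LinearMap.toContinuousLinearMap H := by
      rw [ContinuousLinearMap.star_eq_adjoint, ← LinearMap.adjoint_toContinuousLinearMap]
      rw [LinearMap.isSelfAdjoint_iff'.mp ((LinearMap.isSymmetric_iff_isSelfAdjoint H).mp hH)]
    simp only [K, star_smul, hs]
    congr 1
    simp
  have hT : star (NormedSpace.exp K) = NormedSpace.exp K := by
    rw [NormedSpace.star_exp, hK]
  have hexp : NormedSpace.exp ((-β : ℂ) • LinearMap.toContinuousLinearMap H)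
      = NormedSpace.exp K * NormedSpace.exp K := by
    rw [← NormedSpace.exp_add_of_commute (Commute.refl K), ← add_smul]
    congr 2
    ring
  refine ⟨(NormedSpace.exp K).toLinearMap, ?_, ?_⟩
  · exact (NormedSpace.isUnit_exp K).map
      (ContinuousLinearMap.toLinearMapRingHom (R₁ := ℂ) (M₁ := E))
  · have hadj : LinearMap.adjoint (NormedSpace.exp K).toLinearMap
        = (NormedSpace.exp K).toLinearMap := by
      rw [← LinearMap.isSelfAdjoint_iff', ← LinearMap.isSymmetric_iff_isSelfAdjoint]
      exact (ContinuousLinearMap.isSelfAdjoint_iff_isSymmetric).mp hT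
    rw [hadj, expOp, hexp]
    rfl

theorem expOp_inner_pos (β : ℝ) {H : Op E} (hH : H.IsSymmetric) {v : E} (hv : v ≠ 0) :
    0 < inner ℂ v (expOp β H v) := by
  obtain ⟨T, hT, h⟩ := expOp_eq_adjoint_mul_self β hH
  rw [h, Module.End.mul_apply, LinearMap.adjoint_inner_right, inner_self_eq_norm_sq_to_K]
  have hTv : T v ≠ 0 := fun h0 => hv (((Module.End.isUnit_iff T).mp hT).injective (by simpa using h0))
  have : (0 : ℝ) < ‖T v‖ ^ 2 := by positivity
  rw [← RCLike.ofReal_pow]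
  exact Complex.zero_lt_real.mpr this

theorem gibbs_inner_pos (β : ℝ) {H : Op E} (hH : H.IsSymmetric) {v : E} (hv : v ≠ 0) :
    0 < inner ℂ v (gibbs β H v) := by
  have ht : 0 < LinearMap.trace ℂ E (expOp β H) := by
    rw [LinearMap.trace_eq_sum_inner _ (stdOrthonormalBasis ℂ E)]
    have : Nontrivial E := ⟨v, 0, hv⟩
    refine Finset.sum_pos (fun i _ =>
      expOp_inner_pos β hH ((stdOrthonormalBasis ℂ E).orthonormal.ne_zero i)) ?_
    exact ⟨⟨0, Module.finrank_pos⟩, Finset.mem_univ _⟩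
  rw [gibbs, LinearMap.smul_apply, inner_smul_right]
  exact mul_pos (inv_pos.mpr ht) (expOp_inner_pos β hH hv)

theorem gibbs_isSymmetric (β : ℝ) {H : Op E} (hH : H.IsSymmetric) :
    (gibbs β H).IsSymmetric := by
  rw [LinearMap.isSymmetric_iff_inner_map_self_real]
  intro v
  by_cases hv : v = 0
  · simp [hv]
  · have h := gibbs_inner_pos β hH hv
    rw [← inner_conj_symm (gibbs β H v) v]
    exact congrArg _ (Complex.conj_eq_iff_im.mpr (Complex.pos_iff.mp h).2.symm)

theorem exists_gibbs_diagonal (β : ℝ) {H : Op E} (hH : H.IsSymmetric) {ι : Type*} [Fintype ι]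
    [DecidableEq ι] (e : OrthonormalBasis ι ℂ E) (he : IsEigenbasis e (gibbs β H)) :
    ∃ p : ι → ℝ, (∀ i, 0 < p i) ∧ mat e (gibbs β H) = Matrix.diagonal fun i => (p i : ℂ) := by
  choose c hc using he
  have hpos : ∀ i, 0 < c i := fun i => by
    have h := gibbs_inner_pos β hH (e.orthonormal.ne_zero i)
    rw [hc, inner_smul_right, inner_self_eq_norm_sq_to_K, e.orthonormal.1 i] at h
    simpa using h
  refine ⟨fun i => (c i).re, fun i => (Complex.pos_iff.mp (hpos i)).1, ?_⟩
  rw [mat_eq_diagonal hc]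
  congr 1
  ext i
  exact Complex.ext (by simp) (by simpa using (Complex.pos_iff.mp (hpos i)).2.symm)

end Gibbs

/-! ### From the Lindblad form and detailed balance to a compact representation -/

section Balance

variable {E : Type*} [NormedAddCommGroup E] [InnerProductSpace ℂ E] [FiniteDimensional ℂ E]
  {ι : Type*} [Fintype ι] [DecidableEq ι]

/-- A Lindblad operator has a positive semidefinite coefficient matrix. -/
theorem IsLindblad.exists_coeff {L : Op E →ₗ[ℂ] Op E} (hL : IsLindblad L)
    (e : OrthonormalBasis ι ℂ E) :
    ∃ C : Matrix (ι × ι) (ι × ι) ℂ, C.PosSemidef ∧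
      ∀ A, mat e (L A) = lindbladMatrix C (mat e A) := by
  obtain ⟨k, a, Q, ha, hLA⟩ := hL
  let q : Fin k → Matrix ι ι ℂ := fun n => mat e (Q n)
  -- The columns of `V` are the vectorized `Q n`, so `V * a * Vᴴ` is positive semidefinite along
  -- with `a`.
  let V : Matrix (ι × ι) (Fin k) ℂ := Matrix.of fun i n => q n i.1 i.2
  have hC : ∀ i j, (V * a * Vᴴ) i j
      = ∑ n, ∑ m, a n m * (q n i.1 i.2 * star (q m j.1 j.2)) := by
    intro i j
    simp only [Matrix.mul_apply, Matrix.conjTranspose_apply, V, Matrix.of_apply, Finset.sum_mul]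
    rw [Finset.sum_comm]
    exact Finset.sum_congr rfl fun n _ => Finset.sum_congr rfl fun m _ => by ring
  have hD : dissipator (V * a * Vᴴ) = ∑ n, ∑ m, a n m • ((q m)ᴴ * q n) := by
    ext y x
    simp only [dissipator, Matrix.of_apply, hC, Matrix.sum_apply, Matrix.smul_apply,
      Matrix.mul_apply, Matrix.conjTranspose_apply, smul_eq_mul, Finset.mul_sum]
    rw [Finset.sum_comm]
    refine Finset.sum_congr rfl fun n _ => ?_
    rw [Finset.sum_comm]
    exact Finset.sum_congr rfl fun m _ => Finset.sum_congr rfl fun z _ => by ring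
  refine ⟨V * a * Vᴴ, ha.mul_mul_conjTranspose_same V, fun A => ?_⟩
  ext z w
  rw [lindbladMatrix_apply, hD, hLA]
  simp only [hC, map_sum, map_smul, map_add, Ring.lie_def, map_sub, map_mul, mat_adjoint,
    Matrix.sum_apply, Matrix.smul_apply, Matrix.add_apply, Matrix.sub_apply, smul_eq_mul,
    Finset.sum_mul, Finset.mul_sum, smul_mul_assoc, mul_smul_comm]
  have hcp : ∑ x, ∑ y, ∑ n, ∑ m, 2 * (a n m * (q n z x * star (q m w y)) * mat e A x y)
      = ∑ n, ∑ m, 2 * (a n m * (q n * mat e A * (q m)ᴴ) z w) := by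
    simp only [Matrix.mul_apply, Matrix.conjTranspose_apply, Finset.sum_mul, Finset.mul_sum]
    calc _ = ∑ x, ∑ n, ∑ m, ∑ y, 2 * (a n m * (q n z x * star (q m w y)) * mat e A x y) := by
          refine Finset.sum_congr rfl fun x _ => ?_
          rw [Finset.sum_comm]
          exact Finset.sum_congr rfl fun n _ => Finset.sum_comm
      _ = ∑ n, ∑ m, ∑ x, ∑ y, 2 * (a n m * (q n z x * star (q m w y)) * mat e A x y) := by
          rw [Finset.sum_comm]
          exact Finset.sum_congr rfl fun n _ => Finset.sum_comm
      _ = _ := by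
          refine Finset.sum_congr rfl fun n _ => Finset.sum_congr rfl fun m _ => ?_
          rw [Finset.sum_comm]
          exact Finset.sum_congr rfl fun x _ => Finset.sum_congr rfl fun y _ => by ring
  rw [hcp, ← Finset.sum_sub_distrib, ← Finset.sum_sub_distrib]
  refine Finset.sum_congr rfl fun n _ => ?_
  rw [← Finset.sum_sub_distrib, ← Finset.sum_sub_distrib]
  refine Finset.sum_congr rfl fun m _ => ?_
  simp only [q, mul_assoc]
  ring

theorem hs_single (e : OrthonormalBasis ι ℂ E) (z w : ι) (B : Op E) :
    hs ((mat e).symm (Matrix.single z w 1)) B = mat e B z w := by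
  rw [hs, LinearMap.trace_eq_matrix_trace ℂ e.toBasis]
  change (mat e _).trace = _
  rw [map_mul, mat_adjoint, AlgEquiv.apply_symm_apply]
  simp [Matrix.trace_single_mul]

/-- The detailed balance condition on matrix entries. -/
theorem IsDBC.entry {L : Op E →ₗ[ℂ] Op E} {S : Op E} (h : IsDBC L S)
    {e : OrthonormalBasis ι ℂ E} {p : ι → ℝ}
    (hS : mat e S = Matrix.diagonal fun i => (p i : ℂ)) {C : Matrix (ι × ι) (ι × ι) ℂ}
    (hC : ∀ A, mat e (L A) = lindbladMatrix C (mat e A)) (z w x y : ι) :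
    (p y : ℂ) * lindbladEntry C z w x y = p w * star (lindbladEntry C x y z w) := by
  let u : ι → ι → Op E := fun i j => (mat e).symm (Matrix.single i j 1)
  have hu : ∀ i j, mat e (u i j) = Matrix.single i j 1 := fun i j => AlgEquiv.apply_symm_apply _ _
  have huS : ∀ i j, u i j * S = (p j : ℂ) • u i j := by
    intro i j
    apply (mat e).injective
    ext k l
    rw [map_mul, map_smul, hS, hu, Matrix.mul_diagonal, Matrix.smul_apply, Matrix.single_apply]
    split_ifs with hij
    · simp [hij.2]
    · simp
  have key : ∀ i j k l, hs (u i j) (L (u k l)) = lindbladEntry C i j k l := by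
    intro i j k l
    rw [hs_single, hC, hu, lindbladMatrix_single]
  have hSs : LinearMap.adjoint S = S := by
    apply (mat e).injective
    rw [mat_adjoint, hS, Matrix.diagonal_conjTranspose]
    congr 1
    ext i
    simp
  have hmove : ∀ A B : Op E, hs A (B * S) = hs (A * S) B := by
    intro A B
    have hadj : LinearMap.adjoint (A * S) = S * LinearMap.adjoint A := by
      rw [Module.End.mul_eq_comp, LinearMap.adjoint_comp, hSs, Module.End.mul_eq_comp]
    rw [hs, hs, hadj, ← mul_assoc, LinearMap.trace_mul_comm ℂ (_ * B), ← mul_assoc]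
  -- On matrix units, right multiplication by `S` only produces the factors `p y` and `p w`; the
  -- second is moved across the scalar product since `S` is self-adjoint.
  have h1 := h.2 (u z w) (u x y)
  rw [hs_hsAdjoint, hmove _ (hsAdjoint _ _), ← hs_conj (hsAdjoint _ _), hs_hsAdjoint, huS, huS, map_smul, map_smul] at h1
  have hsm : ∀ (A B : Op E) (c : ℂ), hs A (c • B) = c * hs A B := fun A B c => by simp [hs]
  rw [hsm, hsm, key, key, map_mul, Complex.conj_ofReal] at h1
  exact h1

theorem exists_isCompactRep {L : Op E →ₗ[ℂ] Op E} (hL : IsLindblad L) {S : Op E}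
    (h : IsDBC L S) {e : OrthonormalBasis ι ℂ E} {p : ι → ℝ} (hp : ∀ i, 0 < p i)
    (hS : mat e S = Matrix.diagonal fun i => (p i : ℂ)) :
    ∃ Q : Op (E ⊗[ℂ] E), Q.IsSymmetric ∧
      ⁅Q, (TensorProduct.map S S : Op (E ⊗[ℂ] E))⁆ = 0 ∧ IsCompactRep L Q S := by
  obtain ⟨C, hC, hLC⟩ := hL.exists_coeff e
  obtain ⟨C', hC', hent, hr, hs⟩ := exists_balanced_coeff hp hC (h.entry hS hLC)
  obtain ⟨q, hq, hq0, hqC⟩ := exists_repCoeff hp hC' hr hs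
  have hQ : mat₂ e ((mat₂ e).symm q) = q := AlgEquiv.apply_symm_apply _ _
  refine ⟨(mat₂ e).symm q, ?_, ?_, ?_⟩
  · rw [← mat₂_isHermitian_iff e, hQ]
    exact hq
  · exact lie_map_eq_zero hS (by rwa [hQ])
  · rw [isCompactRep_iff hS, hQ, hqC]
    intro A
    rw [hLC, lindbladMatrix, lindbladMatrix, hent]

end Balance

end DBCLindblad

theorem mainTheorem2 {h : Type*} [NormedAddCommGroup h] [InnerProductSpace ℂ h]
    [FiniteDimensional ℂ h] (β : ℝ) (H : DBCLindblad.Op h) (hH : H.IsSymmetric)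
    (L : DBCLindblad.Op h →ₗ[ℂ] DBCLindblad.Op h) (hL : DBCLindblad.IsLindblad L)
    (hDBC : DBCLindblad.IsDBC L (DBCLindblad.gibbs β H)) :
    (∃ Q : DBCLindblad.Op (h ⊗[ℂ] h), Q.IsSymmetric ∧
      ⁅Q, (TensorProduct.map (DBCLindblad.gibbs β H) (DBCLindblad.gibbs β H) :
        DBCLindblad.Op (h ⊗[ℂ] h))⁆ = 0 ∧
      DBCLindblad.IsCompactRep L Q (DBCLindblad.gibbs β H)) ∧
    ∀ Q : DBCLindblad.Op (h ⊗[ℂ] h), Q.IsSymmetric →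
      ⁅Q, (TensorProduct.map (DBCLindblad.gibbs β H) (DBCLindblad.gibbs β H) :
        DBCLindblad.Op (h ⊗[ℂ] h))⁆ = 0 →
      ∀ e : OrthonormalBasis (Fin (Module.finrank ℂ h)) ℂ h,
        DBCLindblad.IsEigenbasis e (DBCLindblad.gibbs β H) →
        (DBCLindblad.IsCompactRep L Q (DBCLindblad.gibbs β H) ↔
          DBCLindblad.IsCompactRep L (DBCLindblad.dualOp e (DBCLindblad.gibbs β H) Q)
            (Ring.inverse (DBCLindblad.gibbs β H))) := by
  have hsymm := DBCLindblad.gibbs_isSymmetric β hH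
  constructor
  · obtain ⟨p, hp, hS⟩ := DBCLindblad.exists_gibbs_diagonal β hH
      (hsymm.eigenvectorBasis rfl) fun j => ⟨_, hsymm.apply_eigenvectorBasis rfl j⟩
    exact DBCLindblad.exists_isCompactRep hL hDBC hp hS
  · intro Q _ _ e he
    obtain ⟨p, hp, hS⟩ := DBCLindblad.exists_gibbs_diagonal β hH e he
    exact DBCLindblad.isCompactRep_dualOp_iff hp hS L Q
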